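/- Let $q$ be a prime power, $R=\mathbb F_q[\theta]$ and $K=\mathbb F_q(\theta)$. Let $P$ run through the monic irreducible elements of $R$, and put $$\mathcal A_K=\Big(\prod_P R/(P)\Big)\Big/\Big(\bigoplus_P R/(P)\Big),$$ a $K$-algebra through the diagonal map. Write $[(x_P \bmod P)_P]\in\mathcal A_K$ for the class of a family of elements $x_P$ that are reducible modulo $P$ for almost all (all but finitely many) $P$. For a finite Galois extension $L/K$ let $R_L$ be the integral closure of $R$ in $L$, and let $A(L)$ be the set of maps $g:\mathrm{Gal}(L/K)\to L$ with $g(\sigma\tau\sigma^{-1})=\sigma(g(\tau))$ for all $\sigma,\tau\in\mathrm{Gal}(L/K)$. For a prime $\mathfrak p$ of $R_L$ over $(P)$, a Frobenius at $\mathfrak p$ is an element $\varphi_{\mathfrak p}\in\mathrm{Gal}(L/K)$ with $\varphi_{\mathfrak p}(x)\equiv x^{\#R/(P)}\pmod{\mathfrak p}$ for all $x\in R_L$; it is unique if $\mathfrak p$ is unramified over $K$. For $g\in A(L)$ and almost all $P$, the residue $g(\varphi_{\mathfrak p})\bmod\mathfrak p$ lies in $R/(P)\subset R_L/\mathfrak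 p$ and is the same element of $R/(P)$ for all $\mathfrak p$ over $(P)$; it is denoted by $g(\varphi_P)\bmod P$, and one puts $\mathrm{ev}_L(g)=[(g(\varphi_P)\bmod P)_P]\in\mathcal A_K$. The $\mathcal A_K$-valued Frobenius $F_{\mathcal A_K,L}$ is the $\mathcal A_K$-linear endomorphism (in fact, automorphism) of $$L\otimes_K\mathcal A_K\;\cong\;\Big(\prod_P R_L/(P)R_L\Big)\Big/\Big(\bigoplus_P R_L/(P)R_L\Big)$$ induced by the $q^{\deg P}$-power maps of the rings $R_L/(P)R_L$. **Theorem.** Let $\alpha\in\mathcal A_K$. The following conditions are equivalent. 1. There is a sequence $(a_n)_{n\ge 0}$ in $K$ satisfying a linear recurrence relation $a_{n+l}=\sum_{i=0}^{l-1}c_i\,a_{n+i}$ $(n\ge 0)$ with $l\ge 0$ and $c_i\in K$, whose eigen polynomial $x^l-\sum_{i=0}^{l-1}c_ix^i\in K[x]$ is a product of separable polynomials in $K[x]$ (polynomials without multiple roots in an algebraic closure), such that $\alpha=[(a_{q^{\deg P}}\bmod P)_P]$. 2. There are a finite Galois extension $L/K$ and $g\in A(L)$ such that $\alpha=\mathrm{ev}_L(g)=[(g(\varphi_P)\bmod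 P)_P]$. 3. There is a finite Galois extension $L/K$ such that, for every basis of $L$ over $K$, $\alpha$ is a $K$-linear combination of the entries of the matrix of $F_{\mathcal A_K,L}$ with respect to the induced $\mathcal A_K$-basis of $L\otimes_K\mathcal A_K$. -/

import Mathlib

open Polynomial TensorProduct Filter

universe u

namespace FiniteSeparable

/-! Throughout, `R = 𝔽_q[θ]` is `Fq[X]` and `K = 𝔽_q(θ)` is `RatFunc Fq`. -/

/-- The monic irreducible elements `P` of `R = 𝔽_q[θ]`. -/
def MonicIrred (Fq : Type u) [Field Fq] : Type u :=
  {P : Fq[X] // P.Monic ∧ Irreducible P}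

/-! ### Rings of the form `∏ A i / ⨁ A i` -/

/-- The direct sum `⨁ i, A i` (families with finite support) as an ideal of `∏ i, A i`. -/
def finSuppIdeal {ι : Type*} (A : ι → Type*) [∀ i, CommRing (A i)] : Ideal (∀ i, A i) where
  carrier := {f | {i | f i ≠ 0}.Finite}
  zero_mem' := by simp
  add_mem' {f g} hf hg := by
    refine (Set.Finite.union hf hg).subset fun i hi => ?_
    by_contra h
    simp only [Set.mem_union, Set.mem_ofPred_eq, not_or, not_not] at h
    exact hi (by simp [h.1, h.2])
  smul_mem' c f hf := by
    refine Set.Finite.subset hf fun i hi h => hi ?_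
    simp [h]

/-- The ring `∏ i, A i / ⨁ i, A i`. -/
abbrev ProdModSum {ι : Type*} (A : ι → Type*) [∀ i, CommRing (A i)] : Type _ :=
  (∀ i, A i) ⧸ finSuppIdeal A

theorem ProdModSum.mk_eq_mk_iff {ι : Type*} {A : ι → Type*} [∀ i, CommRing (A i)]
    (f g : ∀ i, A i) :
    (Ideal.Quotient.mk (finSuppIdeal A) f = Ideal.Quotient.mk (finSuppIdeal A) g) ↔
      ∀ᶠ i in cofinite, f i = g i := by
  rw [Ideal.Quotient.eq, eventually_cofinite]
  change Set.Finite {i | (f - g) i ≠ 0} ↔ _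
  simp [sub_eq_zero]

/-- A family of ring homomorphisms `A i → B i` induces
`∏ A i / ⨁ A i → ∏ B i / ⨁ B i` componentwise. -/
def ProdModSum.map {ι : Type*} {A B : ι → Type*} [∀ i, CommRing (A i)] [∀ i, CommRing (B i)]
    (f : ∀ i, A i →+* B i) : ProdModSum A →+* ProdModSum B :=
  Ideal.quotientMap (finSuppIdeal B)
    (RingHom.pi fun i => (f i).comp (Pi.evalRingHom A i)) (by
      intro x hx
      refine Set.Finite.subset hx fun i hi (h : x i = 0) => hi ?_
      change f i (x i) = 0
      rw [h, map_zero])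

theorem ProdModSum.map_mk {ι : Type*} {A B : ι → Type*} [∀ i, CommRing (A i)]
    [∀ i, CommRing (B i)] (f : ∀ i, A i →+* B i) (x : ∀ i, A i) :
    ProdModSum.map f (Ideal.Quotient.mk _ x) = Ideal.Quotient.mk _ fun i => f i (x i) := rfl

/-! ### The ring `𝒜_K` -/

section AK

variable (Fq : Type u) [Field Fq]

/-- The ring `𝒜_K = ∏_P R/(P) / ⨁_P R/(P)`. -/
def AK : Type u :=
  ProdModSum fun P : MonicIrred Fq => Fq[X] ⧸ Ideal.span {P.1}

noncomputable instance : CommRing (AK Fq) :=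
  inferInstanceAs (CommRing (ProdModSum fun P : MonicIrred Fq => Fq[X] ⧸ Ideal.span {P.1}))

variable {Fq}

/-- The class `[(c_P mod P)_P] ∈ 𝒜_K` of a family of elements `c_P ∈ R`. -/
noncomputable def AK.ofFamily : (MonicIrred Fq → Fq[X]) →+* AK Fq :=
  (Ideal.Quotient.mk (finSuppIdeal fun P : MonicIrred Fq => Fq[X] ⧸ Ideal.span {P.1})).comp
    (RingHom.pi fun P => (Ideal.Quotient.mk _).comp (Pi.evalRingHom _ P))

theorem AK.ofFamily_surjective (x : AK Fq) : ∃ c, AK.ofFamily c = x := by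
  obtain ⟨f, rfl⟩ := Ideal.Quotient.mk_surjective x
  choose c hc using fun P => Ideal.Quotient.mk_surjective (f P)
  exact ⟨c, congrArg _ (funext hc)⟩

theorem AK.ofFamily_eq_iff (c d : MonicIrred Fq → Fq[X]) :
    AK.ofFamily c = AK.ofFamily d ↔ ∀ᶠ P in cofinite, P.1 ∣ c P - d P := by
  refine (ProdModSum.mk_eq_mk_iff _ _).trans (eventually_congr (Eventually.of_forall fun P => ?_))
  change Ideal.Quotient.mk _ (c P) = Ideal.Quotient.mk _ (d P) ↔ _
  rw [Ideal.Quotient.eq, Ideal.mem_span_singleton]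

theorem finite_dvd {r : Fq[X]} (hr : r ≠ 0) : {P : MonicIrred Fq | P.1 ∣ r}.Finite := by
  classical
  refine Set.Finite.of_finite_image
    (((UniqueFactorizationMonoid.normalizedFactors r).toFinset : Set Fq[X]).toFinite.subset ?_)
    Subtype.val_injective.injOn
  rintro _ ⟨P, hP, rfl⟩
  exact Multiset.mem_toFinset.2
    ((Polynomial.mem_normalizedFactors_iff hr).2 ⟨P.2.2, P.2.1, hP⟩)

/-- Nonzero elements of `R` are invertible in `𝒜_K`. -/
theorem AK.isUnit_ofFamily_const (r : Fq[X]) (hr : r ≠ 0) :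
    IsUnit (AK.ofFamily fun _ => r) := by
  have h : ∀ P : MonicIrred Fq, ∃ s : Fq[X], ¬ P.1 ∣ r → P.1 ∣ r * s - 1 := by
    intro P
    by_cases hP : P.1 ∣ r
    · exact ⟨0, fun h => absurd hP h⟩
    · obtain ⟨a, b, hab⟩ := (P.2.2.coprime_iff_not_dvd).2 hP
      exact ⟨b, fun _ => ⟨-a, by linear_combination hab⟩⟩
  choose s hs using h
  refine IsUnit.of_mul_eq_one (AK.ofFamily s) ?_
  rw [← map_mul, ← map_one AK.ofFamily, AK.ofFamily_eq_iff]
  exact eventually_cofinite.2 ((finite_dvd hr).subset fun P hP => by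
    by_contra h
    exact hP (hs P h))

/-- The diagonal `R`-algebra structure of `𝒜_K`. -/
noncomputable instance : Algebra Fq[X] (AK Fq) :=
  (AK.ofFamily.comp (RingHom.pi fun _ => RingHom.id _)).toAlgebra

theorem AK.algebraMap_apply (r : Fq[X]) :
    algebraMap Fq[X] (AK Fq) r = AK.ofFamily fun _ => r := rfl

/-- The diagonal `K`-algebra structure of `𝒜_K`: the unique extension of `R → 𝒜_K` to `K`. -/
noncomputable instance : Algebra (RatFunc Fq) (AK Fq) :=
  (IsLocalization.lift (M := nonZeroDivisors Fq[X]) (S := RatFunc Fq)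
    (g := algebraMap Fq[X] (AK Fq)) fun r =>
      AK.isUnit_ofFamily_const r.1 (nonZeroDivisors.ne_zero r.2)).toAlgebra

instance : IsScalarTower Fq[X] (RatFunc Fq) (AK Fq) :=
  IsScalarTower.of_algebraMap_eq fun r => (IsLocalization.lift_eq _ r).symm

end AK

/-! ### The ring `𝒜_L` and the `𝒜_K`-valued Frobenius -/

section AL

variable (Fq : Type u) [Field Fq] (B : Type u) [CommRing B] [Algebra Fq[X] B]

/-- The ring `∏_P B/(P)B / ⨁_P B/(P)B` for an `R`-algebra `B`. -/
def AL : Type u :=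
  ProdModSum fun P : MonicIrred Fq => B ⧸ Ideal.span {algebraMap Fq[X] B P.1}

noncomputable instance : CommRing (AL Fq B) :=
  inferInstanceAs
    (CommRing (ProdModSum fun P : MonicIrred Fq => B ⧸ Ideal.span {algebraMap Fq[X] B P.1}))

variable {Fq B}

/-- The class `[(c_P mod P)_P]` of a family of elements `c_P ∈ B`. -/
noncomputable def AL.ofFamily : (MonicIrred Fq → B) →+* AL Fq B :=
  (Ideal.Quotient.mk
    (finSuppIdeal fun P : MonicIrred Fq => B ⧸ Ideal.span {algebraMap Fq[X] B P.1})).comp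
    (RingHom.pi fun P => (Ideal.Quotient.mk _).comp (Pi.evalRingHom _ P))

theorem AL.ofFamily_surjective (x : AL Fq B) : ∃ c, AL.ofFamily c = x := by
  obtain ⟨f, rfl⟩ := Ideal.Quotient.mk_surjective x
  choose c hc using fun P => Ideal.Quotient.mk_surjective (f P)
  exact ⟨c, congrArg _ (funext hc)⟩

theorem AL.ofFamily_eq_iff (c d : MonicIrred Fq → B) :
    (AL.ofFamily c : AL Fq B) = AL.ofFamily d ↔
      ∀ᶠ P in cofinite, algebraMap Fq[X] B P.1 ∣ c P - d P := by
  refine (ProdModSum.mk_eq_mk_iff _ _).trans (eventually_congr (Eventually.of_forall fun P => ?_))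
  change Ideal.Quotient.mk _ (c P) = Ideal.Quotient.mk _ (d P) ↔ _
  rw [Ideal.Quotient.eq, Ideal.mem_span_singleton]

/-- The `𝒜_K`-algebra structure induced by the maps `R/(P) → B/(P)B`. -/
noncomputable instance : Algebra (AK Fq) (AL Fq B) :=
  (ProdModSum.map fun P : MonicIrred Fq =>
    (Ideal.quotientMap (I := Ideal.span {P.1}) (Ideal.span {algebraMap Fq[X] B P.1})
      (algebraMap Fq[X] B) (by
        rw [Ideal.span_singleton_le_iff_mem]
        exact Ideal.mem_span_singleton_self _))).toAlgebra

theorem AL.algebraMap_ofFamily (c : MonicIrred Fq → Fq[X]) :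
    algebraMap (AK Fq) (AL Fq B) (AK.ofFamily c) =
      AL.ofFamily fun P => algebraMap Fq[X] B (c P) := rfl

noncomputable instance : Algebra (RatFunc Fq) (AL Fq B) :=
  ((algebraMap (AK Fq) (AL Fq B)).comp (algebraMap (RatFunc Fq) (AK Fq))).toAlgebra

instance : IsScalarTower (RatFunc Fq) (AK Fq) (AL Fq B) :=
  IsScalarTower.of_algebraMap_eq fun _ => rfl

/-- The `q ^ deg P`-power map of an `R`-algebra `S`, as a ring homomorphism. -/
noncomputable def powerMap [Finite Fq] (S : Type u) [CommRing S] [Algebra Fq[X] S]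
    (P : MonicIrred Fq) : S →+* S where
  toFun x := x ^ Nat.card Fq ^ P.1.natDegree
  map_one' := one_pow _
  map_zero' := zero_pow (pow_ne_zero _ Nat.card_pos.ne')
  map_mul' x y := mul_pow x y _
  map_add' x y := by
    have := Fintype.ofFinite Fq
    let _ : Algebra Fq S := ((algebraMap Fq[X] S).comp C).toAlgebra
    have h (n : ℕ) (z : S) : z ^ Nat.card Fq ^ n = ((FiniteField.frobeniusAlgHom Fq S) ^ n) z := by
      induction n with
      | zero => simp
      | succ n ih =>
        rw [pow_succ' (FiniteField.frobeniusAlgHom Fq S), AlgHom.mul_apply, ← ih,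
          FiniteField.frobeniusAlgHom_apply, ← pow_mul, ← Nat.card_eq_fintype_card, pow_succ]
    simp only [h, map_add]

/-- Fermat's little theorem in `R/(P)`. -/
theorem dvd_pow_card_sub [Finite Fq] (P : MonicIrred Fq) (c : Fq[X]) :
    P.1 ∣ c ^ Nat.card Fq ^ P.1.natDegree - c := by
  have hP := P.2.2
  have : Fact (Irreducible P.1) := ⟨hP⟩
  have : (Ideal.span {P.1}).IsMaximal := PrincipalIdealRing.isMaximal_of_irreducible hP
  let _ := Ideal.Quotient.field (Ideal.span {P.1})
  have hfin : Module.Finite Fq (Fq[X] ⧸ Ideal.span {P.1}) :=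
    Module.finite_of_finrank_pos (by
      rw [finrank_quotient_span_eq_natDegree]
      exact hP.natDegree_pos)
  have := Module.finite_of_finite Fq (M := Fq[X] ⧸ Ideal.span {P.1})
  have := Fintype.ofFinite (Fq[X] ⧸ Ideal.span {P.1})
  have h := FiniteField.pow_card (Ideal.Quotient.mk (Ideal.span {P.1}) c)
  rw [← Nat.card_eq_fintype_card, Module.natCard_eq_pow_finrank (K := Fq),
    finrank_quotient_span_eq_natDegree, ← map_pow] at h
  exact Ideal.mem_span_singleton.1 (Ideal.Quotient.eq.1 h)

/-- The `𝒜_K`-algebra endomorphism of `∏_P B/(P)B / ⨁_P B/(P)B` induced by the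
`q ^ deg P`-power maps of the rings `B/(P)B`. -/
noncomputable def AL.frob [Finite Fq] : AL Fq B →ₐ[AK Fq] AL Fq B where
  toRingHom := ProdModSum.map fun P : MonicIrred Fq =>
    powerMap (B ⧸ Ideal.span {algebraMap Fq[X] B P.1}) P
  commutes' a := by
    obtain ⟨c, rfl⟩ := AK.ofFamily_surjective a
    rw [AL.algebraMap_ofFamily]
    change AL.ofFamily (fun P => algebraMap Fq[X] B (c P) ^ Nat.card Fq ^ P.1.natDegree) = _
    rw [AL.ofFamily_eq_iff]
    refine Eventually.of_forall fun P => ?_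
    rw [← map_pow, ← map_sub]
    exact map_dvd _ (dvd_pow_card_sub P (c P))

end AL

section Galois

variable (Fq : Type u) [Field Fq] (L : Type u) [Field L] [Algebra Fq[X] L]

/-- `R_L`, the integral closure of `R` in `L`. -/
abbrev RL : Type u := integralClosure Fq[X] L

/-- The diagonal homomorphism `R_L → 𝒜_L`. -/
noncomputable def AL.diag : RL Fq L →+* AL Fq (RL Fq L) :=
  AL.ofFamily.comp (RingHom.pi fun _ => RingHom.id _)

theorem AL.diag_apply (x : RL Fq L) : AL.diag Fq L x = AL.ofFamily fun _ => x := rfl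

/-- Nonzero elements of `R_L` are invertible in `𝒜_L`. -/
theorem AL.isUnit_diag (x : RL Fq L) (hx : x ≠ 0) : IsUnit (AL.diag Fq L x) := by
  have hx' : IsAlgebraic Fq[X] x :=
    (integralClosure.isIntegral x).isAlgebraic
  obtain ⟨r, hr, y, hy⟩ := hx'.exists_nonzero_dvd (mem_nonZeroDivisors_of_ne_zero hx)
  have h := (AK.isUnit_ofFamily_const r hr).map (algebraMap (AK Fq) (AL Fq (RL Fq L)))
  rw [AL.algebraMap_ofFamily, hy, ← AL.diag_apply, map_mul] at h
  exact isUnit_of_mul_isUnit_left h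

variable [Algebra (RatFunc Fq) L] [IsScalarTower Fq[X] (RatFunc Fq) L]
  [FiniteDimensional (RatFunc Fq) L]

instance : IsFractionRing (RL Fq L) L :=
  integralClosure.isFractionRing_of_finite_extension (RatFunc Fq) L

/-- The unique extension of the diagonal map `R_L → 𝒜_L` to `L`, as a ring homomorphism. -/
noncomputable def AL.ofFieldHom : L →+* AL Fq (RL Fq L) :=
  IsLocalization.lift (M := nonZeroDivisors (RL Fq L)) (g := AL.diag Fq L)
    fun x => AL.isUnit_diag Fq L x.1 (nonZeroDivisors.ne_zero x.2)

theorem AL.ofFieldHom_algebraMap (x : RL Fq L) :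
    AL.ofFieldHom Fq L (algebraMap (RL Fq L) L x) = AL.diag Fq L x :=
  IsLocalization.lift_eq _ x

/-- The canonical homomorphism `L → 𝒜_L`. -/
noncomputable def AL.ofField : L →ₐ[RatFunc Fq] AL Fq (RL Fq L) where
  toRingHom := AL.ofFieldHom Fq L
  commutes' k := by
    have : (AL.ofFieldHom Fq L).comp (algebraMap (RatFunc Fq) L) =
        algebraMap (RatFunc Fq) (AL Fq (RL Fq L)) := by
      refine IsLocalization.ringHom_ext (nonZeroDivisors Fq[X]) ?_
      refine RingHom.ext fun r => ?_
      simp only [RingHom.comp_apply]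
      rw [← IsScalarTower.algebraMap_apply Fq[X] (RatFunc Fq) L,
        IsScalarTower.algebraMap_apply Fq[X] (RL Fq L) L, AL.ofFieldHom_algebraMap,
        IsScalarTower.algebraMap_apply (RatFunc Fq) (AK Fq) (AL Fq (RL Fq L)),
        ← IsScalarTower.algebraMap_apply Fq[X] (RatFunc Fq) (AK Fq), AK.algebraMap_apply,
        AL.algebraMap_ofFamily, AL.diag_apply]
    exact congrArg (fun f : RatFunc Fq →+* AL Fq (RL Fq L) => f k) this

theorem AL.ofField_algebraMap (x : RL Fq L) :
    AL.ofField Fq L (algebraMap (RL Fq L) L x) = AL.ofFamily fun _ => x :=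
  AL.ofFieldHom_algebraMap Fq L x

/-- The canonical homomorphism `𝒜_K ⊗ L → 𝒜_L`, `a ⊗ y ↦ a y`. -/
noncomputable def AL.ofTensor : AK Fq ⊗[RatFunc Fq] L →ₐ[AK Fq] AL Fq (RL Fq L) :=
  Algebra.TensorProduct.lift (Algebra.ofId _ _) (AL.ofField Fq L) fun _ _ => Commute.all _ _

variable [Algebra.IsSeparable (RatFunc Fq) L]

theorem AL.ofTensor_bijective : Function.Bijective (AL.ofTensor Fq L) := by
  have : Module.Finite Fq[X] (RL Fq L) :=
    IsIntegralClosure.finite Fq[X] (RatFunc Fq) L (RL Fq L)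
  have : Module.IsTorsionFree Fq[X] L :=
    Module.IsTorsionFree.trans_faithfulSMul Fq[X] (RatFunc Fq) L
  have : Module.Free Fq[X] (RL Fq L) := inferInstance
  have : IsLocalization (Algebra.algebraMapSubmonoid (RL Fq L) (nonZeroDivisors Fq[X])) L :=
    IsIntegralClosure.isLocalization Fq[X] (RatFunc Fq) L (RL Fq L)
  let b := Module.Free.chooseBasis Fq[X] (RL Fq L)
  let bK := b.localizationLocalization (RatFunc Fq) (nonZeroDivisors Fq[X]) L
  let bT := bK.baseChange (AK Fq)
  have key (c : Module.Free.ChooseBasisIndex Fq[X] (RL Fq L) → MonicIrred Fq → Fq[X]) :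
      AL.ofTensor Fq L (∑ i, AK.ofFamily (c i) • bT i) =
        AL.ofFamily fun P => ∑ i, c i P • b i := by
    have h1 (i) : AL.ofTensor Fq L (bT i) = AL.ofFamily fun _ => b i := by
      simp only [bT, bK, Module.Basis.baseChange_apply,
        Module.Basis.localizationLocalization_apply, AL.ofTensor,
        Algebra.TensorProduct.lift_tmul, map_one, one_mul, AL.ofField_algebraMap]
    have h2 : (fun P => ∑ i, c i P • b i) =
        ∑ i, (fun P => algebraMap Fq[X] (RL Fq L) (c i P)) * (fun _ : MonicIrred Fq => b i) := by
      funext P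
      simp [Finset.sum_apply, Algebra.smul_def]
    rw [map_sum, h2, map_sum]
    refine Finset.sum_congr rfl fun i _ => ?_
    rw [map_smul, h1, Algebra.smul_def, AL.algebraMap_ofFamily, map_mul]
  constructor
  · rw [injective_iff_map_eq_zero]
    intro x hx
    choose c hc using fun i => AK.ofFamily_surjective (bT.repr x i)
    have hx2 : x = ∑ i, AK.ofFamily (c i) • bT i := by
      simp only [hc, bT.sum_repr]
    rw [hx2, key, ← map_zero AL.ofFamily, AL.ofFamily_eq_iff] at hx
    rw [hx2]
    refine Finset.sum_eq_zero fun i _ => ?_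
    suffices AK.ofFamily (c i) = 0 by rw [this, zero_smul]
    rw [← map_zero AK.ofFamily, AK.ofFamily_eq_iff]
    refine hx.mono fun P hP => ?_
    obtain ⟨y, hy⟩ := hP
    have h3 := congrArg (fun z => b.repr z i) hy
    simp only [Pi.zero_apply, sub_zero, b.repr_sum_self, ← Algebra.smul_def, map_smul,
      Finsupp.smul_apply, smul_eq_mul] at h3
    exact ⟨_, by simpa using h3⟩
  · intro y
    obtain ⟨d, rfl⟩ := AL.ofFamily_surjective y
    refine ⟨∑ i, AK.ofFamily (fun P => b.repr (d P) i) • bT i, ?_⟩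
    rw [key]
    simp only [b.sum_repr]

/-- The canonical isomorphism `𝒜_K ⊗ L ≅ 𝒜_L = ∏_P R_L/(P)R_L / ⨁_P R_L/(P)R_L`. -/
noncomputable def AL.tensorEquiv : AK Fq ⊗[RatFunc Fq] L ≃ₐ[AK Fq] AL Fq (RL Fq L) :=
  AlgEquiv.ofBijective (AL.ofTensor Fq L) (AL.ofTensor_bijective Fq L)

/-- The `𝒜_K`-valued Frobenius `F : L ⊗ 𝒜_K → L ⊗ 𝒜_K`, induced by the `q ^ deg P`-power maps
on `R_L/(P)R_L`. (The factors are written in the order `𝒜_K ⊗ L`.) -/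
noncomputable def frobAK [Finite Fq] :
    AK Fq ⊗[RatFunc Fq] L →ₐ[AK Fq] AK Fq ⊗[RatFunc Fq] L :=
  ((AL.tensorEquiv Fq L).symm : AL Fq (RL Fq L) →ₐ[AK Fq] AK Fq ⊗[RatFunc Fq] L).comp
    (AL.frob.comp (AL.tensorEquiv Fq L : AK Fq ⊗[RatFunc Fq] L →ₐ[AK Fq] AL Fq (RL Fq L)))

end Galois

/-! ### Reductions of elements of `K` and of `L` -/

/-- For a prime ideal `I` of a domain `B` with fraction field `F`: the element `x` of `F` lies in
the local ring `B_I`, and `x ≡ c` modulo its maximal ideal. -/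
def CongrMod {B F : Type*} [CommRing B] [Field F] [Algebra B F] (I : Ideal B) (x : F) (c : B) :
    Prop :=
  ∃ a b : B, b ∉ I ∧ x * algebraMap B F b = algebraMap B F a ∧ a - c * b ∈ I

/-- `α = [(x_P mod P)_P]` in `𝒜_K`, for elements `x_P` of `K` (almost all of them `P`-integral). -/
def IsClassOf {Fq : Type u} [Field Fq] (α : AK Fq) (x : MonicIrred Fq → RatFunc Fq) : Prop :=
  ∃ c : MonicIrred Fq → Fq[X], α = AK.ofFamily c ∧
    ∀ᶠ P in cofinite, CongrMod (Ideal.span {P.1}) (x P) (c P)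

/-- `α = ev_L(g) = [(g(φ_P) mod P)_P]` in `𝒜_K`: there are `c_P ∈ R` with `α = [(c_P mod P)_P]`
such that for almost all `P` and for every prime `𝔭` of `R_L` over `(P)` with Frobenius
`φ` (that is, `φ x ≡ x ^ #(R/(P))` modulo `𝔭` on `R_L`), one has `g(φ) ≡ c_P` modulo `𝔭`. -/
def IsFrobEval {Fq : Type u} [Field Fq] {L : Type u} [Field L] [Algebra (RatFunc Fq) L]
    [Algebra Fq[X] L] [IsScalarTower Fq[X] (RatFunc Fq) L] [FiniteDimensional (RatFunc Fq) L]
    (g : Gal(L/RatFunc Fq) → L) (α : AK Fq) : Prop :=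
  ∃ c : MonicIrred Fq → Fq[X], α = AK.ofFamily c ∧
    ∀ᶠ P in cofinite, ∀ 𝔭 : Ideal (RL Fq L), 𝔭.IsPrime → 𝔭.LiesOver (Ideal.span {P.1}) →
      ∀ φ : Gal(L/RatFunc Fq),
        AlgHom.IsArithFrobAt
          (galRestrict Fq[X] (RatFunc Fq) L (RL Fq L) φ : RL Fq L →ₐ[Fq[X]] RL Fq L) 𝔭 →
        CongrMod 𝔭 (g φ) (algebraMap Fq[X] (RL Fq L) (c P))

/-- `f` is a (finite, possibly empty) product of separable polynomials. -/
def IsProdSeparable {k : Type*} [Field k] (f : k[X]) : Prop :=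
  ∃ s : Multiset k[X], (∀ h ∈ s, h.Separable) ∧ s.prod = f

end FiniteSeparable

open FiniteSeparable

/-!
The three conditions are linked by the functions `g : Gal(L/K) → L` of the form
`frobTrace z y : τ ↦ ∑ σ, ∑ j, σ (z j) * τ (σ (y j))`, which are equivariant. Since the functions
`τ ↦ τ (b j)` for a basis `b` of `L` span all functions on the Galois group, averaging with an
element of trace `1` shows that every equivariant `g` is `frobTrace z b` for some `z`
(`exists_frobTrace_eq`).

Modulo a prime `𝔭` over `P` with Frobenius `φ` and `N = q ^ deg P`, the residue of
`frobTrace z b φ` can be computed in two ways. First, `φ x ≡ x ^ N`, so it is the residue of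
`∑ j, Tr (z j * b j ^ N)`, the `N`-th term of a recurrent sequence in `K` whose eigen polynomial is
the product of the minimal polynomials of the `b j` (`exists_linearRecurrence_trace`). Second, if
`M` is the matrix of the `𝒜_K`-valued Frobenius, then `(b j) ^ N ≡ ∑ i, M i j * b i` modulo every
prime over `P`, so it is the residue of `∑ i, ∑ j, Tr (z j * b i) * M i j`
(`isFrobEval_frobTrace_basis`). As `z` varies, the coefficients `Tr (z j * b i)` take all values
in `K`, by the trace dual basis. This gives the passage from equivariant functions to recurrent
sequences, and the equivalence with the span of the matrix entries (`mem_span_matrix_iff`).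

Conversely, let `a` satisfy a recurrence whose eigen polynomial is a product of separable
polynomials; it splits in a finite Galois extension `L`. The linear functional `X ^ n ↦ a n` on
`L[X]` kills the eigen polynomial, which divides `(∏ x, (X - x)) ^ p ^ m` for the product over its
distinct roots and `m` large. Raising the Lagrange interpolation formula for `X ^ n` to the power
`p ^ m`, an additive operation, yields `a (p ^ m * n) = ∑ x, c x * x ^ (p ^ m * n)` with
coefficients that satisfy `c (σ x) = σ (c x)` (`exists_eq_sum_pow_of_isSolution`): multiple roots
contribute no polynomial factors at exponents divisible by `p ^ m`. Hence `a (q ^ deg P)` is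
congruent to `∑ x, c x * φ x` for almost all `P`, and `τ ↦ ∑ x, c x * τ x` is equivariant.
-/

namespace FiniteSeparable

/-! ### Congruences modulo a prime -/

namespace CongrMod

variable {B F : Type*} [CommRing B] [Field F] [Algebra B F] {I : Ideal B} {x y : F} {c d : B}

theorem congr_right (h : CongrMod I x c) (hcd : c - d ∈ I) : CongrMod I x d := by
  obtain ⟨a, b, hb, hx, hc⟩ := h
  refine ⟨a, b, hb, hx, ?_⟩
  have : a - d * b = a - c * b + (c - d) * b := by ring
  rw [this]
  exact I.add_mem hc (I.mul_mem_right _ hcd)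

variable [hI : I.IsPrime]

theorem of_algebraMap (c : B) : CongrMod I (algebraMap B F c) c :=
  ⟨c, 1, fun h => hI.ne_top (I.eq_top_of_isUnit_mem h isUnit_one), by simp, by simp⟩

theorem add (hx : CongrMod I x c) (hy : CongrMod I y d) : CongrMod I (x + y) (c + d) := by
  obtain ⟨a, b, hb, hx, hc⟩ := hx
  obtain ⟨a', b', hb', hy, hd⟩ := hy
  refine ⟨a * b' + a' * b, b * b', fun h => (hI.mem_or_mem h).elim hb hb', ?_, ?_⟩
  · simp only [map_add, map_mul]
    linear_combination algebraMap B F b' * hx + algebraMap B F b * hy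
  · have : a * b' + a' * b - (c + d) * (b * b') = b' * (a - c * b) + b * (a' - d * b') := by ring
    rw [this]
    exact I.add_mem (I.mul_mem_left _ hc) (I.mul_mem_left _ hd)

theorem mul (hx : CongrMod I x c) (hy : CongrMod I y d) : CongrMod I (x * y) (c * d) := by
  obtain ⟨a, b, hb, hx, hc⟩ := hx
  obtain ⟨a', b', hb', hy, hd⟩ := hy
  refine ⟨a * a', b * b', fun h => (hI.mem_or_mem h).elim hb hb', ?_, ?_⟩
  · simp only [map_mul]
    linear_combination y * algebraMap B F b' * hx + algebraMap B F a * hy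
  · have : a * a' - c * d * (b * b') = a' * (a - c * b) + c * b * (a' - d * b') := by ring
    rw [this]
    exact I.add_mem (I.mul_mem_left _ hc) (I.mul_mem_left _ hd)

theorem pow (hx : CongrMod I x c) (n : ℕ) : CongrMod I (x ^ n) (c ^ n) := by
  induction n with
  | zero => simpa using of_algebraMap (I := I) (F := F) 1
  | succ n ih => simpa only [pow_succ] using ih.mul hx

theorem sum {ι : Type*} (s : Finset ι) {x : ι → F} {c : ι → B}
    (h : ∀ i ∈ s, CongrMod I (x i) (c i)) :
    CongrMod I (∑ i ∈ s, x i) (∑ i ∈ s, c i) := by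
  classical
  induction s using Finset.induction_on with
  | empty => simpa using of_algebraMap (I := I) (F := F) 0
  | insert i s hi ih =>
    rw [Finset.sum_insert hi, Finset.sum_insert hi]
    exact (h i (Finset.mem_insert_self i s)).add
      (ih fun j hj => h j (Finset.mem_insert_of_mem hj))

/-- Residues are unique. -/
theorem sub_mem [FaithfulSMul B F] (h : CongrMod I x c) (h' : CongrMod I x d) : c - d ∈ I := by
  obtain ⟨a, b, hb, hx, hc⟩ := h
  obtain ⟨a', b', hb', hx', hd⟩ := h'
  have key : a * b' = a' * b := by
    apply FaithfulSMul.algebraMap_injective B F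
    rw [map_mul, map_mul, ← hx, ← hx']
    ring
  have : (c - d) * (b * b') ∈ I := by
    have e : (c - d) * (b * b') = b * (a' - d * b') - b' * (a - c * b) := by
      linear_combination key
    rw [e]
    exact I.sub_mem (I.mul_mem_left _ hd) (I.mul_mem_left _ hc)
  exact (hI.mem_or_mem this).resolve_right fun h => (hI.mem_or_mem h).elim hb hb'

end CongrMod

/-! ### Frobenius places -/

section LiesOver

variable {Fq : Type u} [Field Fq] {B : Type u} [CommRing B] [Algebra Fq[X] B]

theorem algebraMap_mem_iff {P : Fq[X]} (𝔭 : Ideal B)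
    [h : 𝔭.LiesOver (Ideal.span {P})] (r : Fq[X]) :
    algebraMap Fq[X] B r ∈ 𝔭 ↔ P ∣ r := by
  rw [← Ideal.mem_span_singleton, h.over, Ideal.mem_comap]

theorem mem_of_dvd {P : Fq[X]} (𝔭 : Ideal B)
    [h : 𝔭.LiesOver (Ideal.span {P})] {x : B} (hx : algebraMap Fq[X] B P ∣ x) :
    x ∈ 𝔭 :=
  𝔭.mem_of_dvd hx ((algebraMap_mem_iff 𝔭 P).2 dvd_rfl)

theorem card_quotient_span [Finite Fq] (P : MonicIrred Fq) :
    Nat.card (Fq[X] ⧸ Ideal.span {P.1}) = Nat.card Fq ^ P.1.natDegree := by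
  have hfin : Module.Finite Fq (Fq[X] ⧸ Ideal.span {P.1}) :=
    Module.finite_of_finrank_pos (by
      rw [finrank_quotient_span_eq_natDegree]
      exact P.2.2.natDegree_pos)
  rw [Module.natCard_eq_pow_finrank (K := Fq), finrank_quotient_span_eq_natDegree]

end LiesOver

section Places

variable (Fq : Type u) [Field Fq] (L : Type u) [Field L] [Algebra (RatFunc Fq) L]
  [Algebra Fq[X] L] [IsScalarTower Fq[X] (RatFunc Fq) L] [FiniteDimensional (RatFunc Fq) L]

/-- A prime `𝔭` of `R_L` lying over a monic irreducible `P`, together with a Frobenius at `𝔭`. -/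
structure FrobPlace where
  /-- the prime of `R` below -/
  base : MonicIrred Fq
  /-- the prime of `R_L` -/
  prime : Ideal (RL Fq L)
  /-- the Frobenius -/
  frob : Gal(L/RatFunc Fq)
  isPrime : prime.IsPrime
  liesOver : prime.LiesOver (Ideal.span {base.1})
  isFrob : AlgHom.IsArithFrobAt
    (galRestrict Fq[X] (RatFunc Fq) L (RL Fq L) frob : RL Fq L →ₐ[Fq[X]] RL Fq L) prime

attribute [instance] FrobPlace.isPrime FrobPlace.liesOver

/-- The filter on Frobenius places for which a property holds eventually when it holds at all
places over almost all `P`. -/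
def frobPlaces : Filter (FrobPlace Fq L) := comap FrobPlace.base cofinite

variable {Fq L}

theorem FrobPlace.eventually_base {p : MonicIrred Fq → Prop} (h : ∀ᶠ P in cofinite, p P) :
    ∀ᶠ t in frobPlaces Fq L, p t.base :=
  h.comap _

/-- `IsFrobEval` in terms of the filter of Frobenius places. -/
theorem isFrobEval_iff {g : Gal(L/RatFunc Fq) → L} {α : AK Fq} :
    IsFrobEval g α ↔ ∃ c : MonicIrred Fq → Fq[X], α = AK.ofFamily c ∧
      ∀ᶠ t in frobPlaces Fq L,
        CongrMod t.prime (g t.frob) (algebraMap Fq[X] (RL Fq L) (c t.base)) := by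
  unfold IsFrobEval frobPlaces
  simp only [eventually_comap]
  refine exists_congr fun c => and_congr_right fun _ =>
    eventually_congr (Eventually.of_forall fun P => ⟨?_, ?_⟩)
  · rintro h ⟨P', 𝔭, φ, h1, h2, h3⟩ rfl
    exact h 𝔭 h1 h2 φ h3
  · intro h 𝔭 h1 h2 φ h3
    exact h ⟨P, 𝔭, φ, h1, h2, h3⟩ rfl

/-- The image of `y ∈ L` in `𝒜_L` gives its residues at almost all primes of `R_L`. -/
theorem congrMod_of_ofField_eq {y : L} {β : MonicIrred Fq → RL Fq L}
    (h : AL.ofField Fq L y = AL.ofFamily β) :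
    ∀ᶠ P in cofinite, ∀ 𝔭 : Ideal (RL Fq L), 𝔭.IsPrime → 𝔭.LiesOver (Ideal.span {P.1}) →
      CongrMod 𝔭 y (β P) := by
  obtain ⟨a, b, hb, rfl⟩ := IsFractionRing.div_surjective (A := RL Fq L) y
  have hb0 : b ≠ 0 := nonZeroDivisors.ne_zero hb
  have hb1 : algebraMap (RL Fq L) L b ≠ 0 := by
    simpa using hb0
  have hy := div_mul_cancel₀ (algebraMap (RL Fq L) L a) hb1
  obtain ⟨r, hr, hbr⟩ := (integralClosure.isIntegral b).isAlgebraic.exists_nonzero_dvd hb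
  have e := congrArg (AL.ofField Fq L) hy
  rw [map_mul, h, AL.ofField_algebraMap, AL.ofField_algebraMap, ← map_mul,
    AL.ofFamily_eq_iff] at e
  filter_upwards [e, (finite_dvd hr).compl_mem_cofinite] with P hP hPr 𝔭 _ _
  refine ⟨a, b, fun hb' => hPr ((algebraMap_mem_iff 𝔭 r).1 (𝔭.mem_of_dvd hbr hb')), hy, ?_⟩
  rw [← neg_mem_iff, neg_sub]
  exact mem_of_dvd 𝔭 hP

/-- An element of `L` is integral at the primes over `P` for almost all `P`. -/
theorem exists_residue (y : L) :
    ∃ β : MonicIrred Fq → RL Fq L,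
      ∀ᶠ t in frobPlaces Fq L, CongrMod t.prime y (β t.base) := by
  obtain ⟨β, hβ⟩ := AL.ofFamily_surjective (AL.ofField Fq L y)
  refine ⟨β, ?_⟩
  filter_upwards [FrobPlace.eventually_base (congrMod_of_ofField_eq hβ.symm)] with t ht
  exact ht _ t.isPrime t.liesOver

/-- A family of representatives of the diagonal image of `k ∈ K` gives the residues of `k`. -/
theorem congrMod_algebraMap {k : RatFunc Fq} {κ : MonicIrred Fq → Fq[X]}
    (h : algebraMap (RatFunc Fq) (AK Fq) k = AK.ofFamily κ) :
    ∀ᶠ t in frobPlaces Fq L, CongrMod t.prime (algebraMap (RatFunc Fq) L k)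
      (algebraMap Fq[X] (RL Fq L) (κ t.base)) := by
  have : AL.ofField Fq L (algebraMap (RatFunc Fq) L k) =
      AL.ofFamily fun P => algebraMap Fq[X] (RL Fq L) (κ P) := by
    rw [AlgHom.commutes, IsScalarTower.algebraMap_apply (RatFunc Fq) (AK Fq), h,
      AL.algebraMap_ofFamily]
  filter_upwards [FrobPlace.eventually_base (congrMod_of_ofField_eq this)] with t ht
  exact ht _ t.isPrime t.liesOver

theorem FrobPlace.frob_sub_pow_mem [Finite Fq] (t : FrobPlace Fq L) (x : RL Fq L) :
    galRestrict Fq[X] (RatFunc Fq) L (RL Fq L) t.frob x -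
      x ^ Nat.card Fq ^ t.base.1.natDegree ∈ t.prime := by
  have := t.isFrob x
  rwa [← t.liesOver.over, card_quotient_span] at this

/-- The Frobenius at `𝔭` acts on the local ring at `𝔭` and induces the power map on residues. -/
theorem CongrMod.frob [Finite Fq] {t : FrobPlace Fq L} {y : L} {c : RL Fq L}
    (h : CongrMod t.prime y c) :
    CongrMod t.prime (t.frob y) (c ^ Nat.card Fq ^ t.base.1.natDegree) := by
  obtain ⟨a, b, hb, hy, hc⟩ := h
  set φ := galRestrict Fq[X] (RatFunc Fq) L (RL Fq L) t.frob with hφ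
  have hφb : φ b ∉ t.prime := fun h =>
    hb (t.isPrime.mem_of_pow_mem _ ((t.prime.sub_mem_iff_right h).1 (t.frob_sub_pow_mem b)))
  refine ⟨φ a, φ b, hφb, ?_, ?_⟩
  · rw [algebraMap_galRestrict_apply, algebraMap_galRestrict_apply, ← map_mul, hy]
  · rw [← Ideal.Quotient.eq] at hc ⊢
    have h1 := fun x => (Ideal.Quotient.eq (I := t.prime)).2 (t.frob_sub_pow_mem x)
    rw [h1, map_mul, h1, ← map_mul, ← mul_pow, map_pow, hc, ← map_pow]

/-- Conjugation carries congruences modulo `σ⁻¹ 𝔭` to congruences modulo `𝔭`. -/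
theorem CongrMod.galRestrict_of_comap {𝔭 : Ideal (RL Fq L)} (σ : Gal(L/RatFunc Fq)) {y : L}
    {c : RL Fq L}
    (h : CongrMod (𝔭.comap (galRestrict Fq[X] (RatFunc Fq) L (RL Fq L) σ)) y c) :
    CongrMod 𝔭 (σ y) (galRestrict Fq[X] (RatFunc Fq) L (RL Fq L) σ c) := by
  obtain ⟨a, b, hb, hy, hc⟩ := h
  refine ⟨galRestrict Fq[X] (RatFunc Fq) L (RL Fq L) σ a,
    galRestrict Fq[X] (RatFunc Fq) L (RL Fq L) σ b, hb, ?_, ?_⟩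
  · rw [algebraMap_galRestrict_apply, algebraMap_galRestrict_apply, ← map_mul, hy]
  · rw [← map_mul, ← map_sub]
    exact hc

theorem liesOver_comap_galRestrict {P : Ideal Fq[X]} {𝔭 : Ideal (RL Fq L)} [h : 𝔭.LiesOver P]
    (σ : Gal(L/RatFunc Fq)) :
    (𝔭.comap (galRestrict Fq[X] (RatFunc Fq) L (RL Fq L) σ)).LiesOver P := by
  refine ⟨?_⟩
  ext r
  rw [h.over, Ideal.mem_comap, Ideal.mem_comap, Ideal.mem_comap, AlgEquiv.commutes]

/-- Residues of all conjugates of `y`, read off from one family representing `y`. -/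
theorem eventually_congrMod_galois {y : L} {β : MonicIrred Fq → RL Fq L}
    (h : AL.ofField Fq L y = AL.ofFamily β) :
    ∀ᶠ t in frobPlaces Fq L, ∀ σ : Gal(L/RatFunc Fq),
      CongrMod t.prime (σ y) (galRestrict Fq[X] (RatFunc Fq) L (RL Fq L) σ (β t.base)) := by
  filter_upwards [FrobPlace.eventually_base (congrMod_of_ofField_eq h)] with t ht σ
  exact (ht _ (Ideal.comap_isPrime _ _) (liesOver_comap_galRestrict σ)).galRestrict_of_comap

/-- At almost all places, `∑ u i * φ (v i)` and `∑ u i * v i ^ q ^ deg P` have the same residue: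
values at the Frobenius `φ` are values of power sums at the exponent `q ^ deg P`. -/
theorem eventually_congrMod_sum_mul_frob [Finite Fq] {ι : Type*} (s : Finset ι) (u v : ι → L) :
    ∀ᶠ t in frobPlaces Fq L, ∃ d : RL Fq L,
      CongrMod t.prime (∑ i ∈ s, u i * t.frob (v i)) d ∧
      CongrMod t.prime (∑ i ∈ s, u i * v i ^ Nat.card Fq ^ t.base.1.natDegree) d := by
  choose μ hμ using fun i => exists_residue (Fq := Fq) (u i)
  choose ν hν using fun i => exists_residue (Fq := Fq) (v i)
  filter_upwards [(Filter.eventually_all_finset s).2 fun i _ => hμ i,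
    (Filter.eventually_all_finset s).2 fun i _ => hν i] with t h1 h2
  exact ⟨_, CongrMod.sum s fun i hi => (h1 i hi).mul (h2 i hi).frob,
    CongrMod.sum s fun i hi => (h1 i hi).mul ((h2 i hi).pow _)⟩

/-- Frobenius places exist over every `P`. -/
theorem FrobPlace.exists_base_eq [Finite Fq] [IsGalois (RatFunc Fq) L] (P : MonicIrred Fq) :
    ∃ t : FrobPlace Fq L, t.base = P := by
  have hmax : (Ideal.span {P.1}).IsMaximal := PrincipalIdealRing.isMaximal_of_irreducible P.2.2
  have : Module.Finite Fq[X] (RL Fq L) :=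
    IsIntegralClosure.finite Fq[X] (RatFunc Fq) L (RL Fq L)
  have : FaithfulSMul Fq[X] (RL Fq L) := by
    have : FaithfulSMul Fq[X] L := FaithfulSMul.trans Fq[X] (RatFunc Fq) L
    infer_instance
  obtain ⟨𝔭, h1, h2⟩ := Ideal.exists_maximal_ideal_liesOver_of_isIntegral
    (S := RL Fq L) (Ideal.span {P.1})
  have hprime := h1.isPrime
  have : Finite (Fq[X] ⧸ Ideal.span {P.1}) :=
    Nat.finite_of_card_ne_zero (by
      rw [card_quotient_span]
      exact pow_ne_zero _ Nat.card_pos.ne')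
  have : Finite (RL Fq L ⧸ 𝔭) :=
    Module.finite_of_finite (Fq[X] ⧸ Ideal.span {P.1})
  have := Algebra.isInvariant_of_isGalois' Fq[X] (RatFunc Fq) L (RL Fq L)
  have : Finite (RL Fq L ≃ₐ[Fq[X]] RL Fq L) :=
    .of_equiv _ (galRestrict Fq[X] (RatFunc Fq) L (RL Fq L)).toEquiv
  obtain ⟨ψ, hψ⟩ := IsArithFrobAt.exists_of_isInvariant Fq[X] (RL Fq L ≃ₐ[Fq[X]] RL Fq L) 𝔭
  refine ⟨⟨P, 𝔭, (galRestrict Fq[X] (RatFunc Fq) L (RL Fq L)).symm ψ, hprime, h2, ?_⟩, rfl⟩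
  rw [MulEquiv.apply_symm_apply]
  exact hψ

end Places

/-! ### Equivariant functions on a Galois group -/

section FrobTrace

variable {K L ι : Type*} [Field K] [Field L] [Algebra K L] [FiniteDimensional K L] [Fintype ι]

/-- The function `τ ↦ ∑ σ, ∑ j, σ (z j) * τ (σ (y j))` on `Gal(L/K)`. -/
noncomputable def frobTrace (z y : ι → L) (τ : Gal(L/K)) : L :=
  ∑ σ : Gal(L/K), ∑ j, σ (z j) * τ (σ (y j))

theorem frobTrace_conj (z y : ι → L) (ρ τ : Gal(L/K)) :
    frobTrace z y (ρ * τ * ρ⁻¹) = ρ (frobTrace z y τ) := by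
  unfold frobTrace
  rw [map_sum]
  refine (Fintype.sum_equiv (Equiv.mulLeft ρ) _ _ fun σ => ?_).symm
  rw [map_sum]
  refine Finset.sum_congr rfl fun j _ => ?_
  simp [AlgEquiv.mul_apply]

variable [IsGalois K L]

/-- The matrix `(τ (b j))` of a basis is invertible, so the functions `τ ↦ τ (b j)` span all
functions on the Galois group. -/
theorem exists_sum_mul_galois_eq (b : Module.Basis ι K L) (h : Gal(L/K) → L) :
    ∃ z : ι → L, ∀ τ, ∑ j, z j * τ (b j) = h τ := by
  classical
  let A : Matrix Gal(L/K) ι L := fun τ j => τ (b j)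
  let A' : Matrix ι Gal(L/K) L := fun j τ => τ (b.traceDual j)
  have hcard : Fintype.card ι = Fintype.card Gal(L/K) := by
    rw [← Module.finrank_eq_card_basis b, ← IsGalois.card_aut_eq_finrank,
      Nat.card_eq_fintype_card]
  have h1 : A' * A = 1 := by
    ext i j
    rw [Matrix.mul_apply]
    simp only [A, A', ← map_mul]
    rw [← trace_eq_sum_automorphisms, b.trace_traceDual_mul, Matrix.one_apply]
    simp [eq_comm]
  have h2 : A * A' = 1 := (Matrix.mul_eq_one_comm_of_card_eq _ _ _ hcard).1 h1
  refine ⟨Matrix.mulVec A' h, fun τ => ?_⟩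
  have h3 : Matrix.mulVec A (Matrix.mulVec A' h) = h := by
    rw [Matrix.mulVec_mulVec, h2, Matrix.one_mulVec]
  rw [← congrFun h3 τ]
  simp only [Matrix.mulVec, dotProduct, A]
  exact Finset.sum_congr rfl fun j _ => mul_comm _ _

/-- Averaging `exists_sum_mul_galois_eq` over the Galois group, with an element of trace `1`. -/
theorem exists_frobTrace_eq (b : Module.Basis ι K L) (g : Gal(L/K) → L)
    (hg : ∀ σ τ : Gal(L/K), g (σ * τ * σ⁻¹) = σ (g τ)) : ∃ z : ι → L, g = frobTrace z b := by
  obtain ⟨c, hc⟩ := Algebra.trace_surjective K L 1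
  obtain ⟨z, hz⟩ := exists_sum_mul_galois_eq b fun τ => c * g τ
  refine ⟨z, funext fun τ => ?_⟩
  have h (σ : Gal(L/K)) : ∑ j, σ (z j) * τ (σ (b j)) = σ c * g τ := by
    have h1 := congrArg σ (hz (σ⁻¹ * τ * σ))
    have h2 := hg σ (σ⁻¹ * τ * σ)
    rw [show σ * (σ⁻¹ * τ * σ) * σ⁻¹ = τ by group] at h2
    rw [map_mul, ← h2, map_sum] at h1
    rw [← h1]
    refine Finset.sum_congr rfl fun j _ => ?_
    have : σ * (σ⁻¹ * τ * σ) = τ * σ := by group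
    rw [map_mul, ← AlgEquiv.mul_apply, ← AlgEquiv.mul_apply, this]
  simp only [frobTrace, h]
  rw [← Finset.sum_mul, ← trace_eq_sum_automorphisms, hc, map_one, one_mul]

end FrobTrace

/-! ### Matrix entries of the Frobenius -/

section Matrix

variable {Fq : Type u} [Field Fq] {L : Type u} [Field L] [Algebra (RatFunc Fq) L]
  [Algebra Fq[X] L] [IsScalarTower Fq[X] (RatFunc Fq) L] [FiniteDimensional (RatFunc Fq) L]
  [Finite Fq] [IsGalois (RatFunc Fq) L]

/-- A function has at most one value at the Frobenius elements, because Frobenius places exist over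
every `P`. -/
theorem IsFrobEval.unique {g : Gal(L/RatFunc Fq) → L} {α β : AK Fq} (hα : IsFrobEval g α)
    (hβ : IsFrobEval g β) : α = β := by
  rw [isFrobEval_iff] at hα hβ
  obtain ⟨c, rfl, hc⟩ := hα
  obtain ⟨d, rfl, hd⟩ := hβ
  rw [AK.ofFamily_eq_iff]
  have h := hc.and hd
  rw [frobPlaces, eventually_comap] at h
  filter_upwards [h] with P hP
  obtain ⟨t, rfl⟩ := FrobPlace.exists_base_eq (L := L) P
  have := (hP t rfl).1.sub_mem (hP t rfl).2
  rwa [← map_sub, algebraMap_mem_iff (P := t.base.1)] at this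

/-- The defining relation `F (b j) = ∑ i, M i j • b i` of the matrix `M` of the Frobenius,
transported to `𝒜_L`. -/
theorem frob_ofField_basis {n : ℕ} (b : Module.Basis (Fin n) (RatFunc Fq) L) (j : Fin n) :
    AL.frob (AL.ofField Fq L (b j)) = ∑ i, LinearMap.toMatrix (b.baseChange (AK Fq))
      (b.baseChange (AK Fq)) (frobAK Fq L).toLinearMap i j • AL.ofField Fq L (b i) := by
  have h1 (i : Fin n) : AL.tensorEquiv Fq L (b.baseChange (AK Fq) i) = AL.ofField Fq L (b i) := by
    change AL.ofTensor Fq L _ = _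
    rw [Module.Basis.baseChange_apply, AL.ofTensor, Algebra.TensorProduct.lift_tmul, map_one,
      one_mul]
  have h2 := (b.baseChange (AK Fq)).sum_repr (frobAK Fq L (b.baseChange (AK Fq) j))
  have h3 := congrArg (AL.tensorEquiv Fq L) h2
  rw [map_sum] at h3
  have h4 : AL.tensorEquiv Fq L (frobAK Fq L (b.baseChange (AK Fq) j)) =
      AL.frob (AL.ofField Fq L (b j)) := by
    rw [← h1]
    exact (AL.tensorEquiv Fq L).apply_symm_apply _
  rw [h4] at h3
  rw [← h3]
  refine Finset.sum_congr rfl fun i _ => ?_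
  rw [map_smul, h1, LinearMap.toMatrix_apply]
  rfl

/-- The value of `frobTrace z b` at the Frobenius elements is the `K`-linear combination of the
matrix entries with coefficients `Tr (z j * b i)`: modulo `𝔭`, the Frobenius sends `σ (b j)` to
`∑ i, M i j * σ (b i)`, and the sum over `σ` turns `σ (z j) * σ (b i)` into a trace. -/
theorem isFrobEval_frobTrace_basis {n : ℕ} (b : Module.Basis (Fin n) (RatFunc Fq) L)
    (z : Fin n → L) :
    IsFrobEval (frobTrace z b) (∑ j, ∑ i, Algebra.trace (RatFunc Fq) L (z j * b i) •
      LinearMap.toMatrix (b.baseChange (AK Fq)) (b.baseChange (AK Fq))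
        (frobAK Fq L).toLinearMap i j) := by
  set M := LinearMap.toMatrix (b.baseChange (AK Fq)) (b.baseChange (AK Fq))
    (frobAK Fq L).toLinearMap with hM
  choose m hm using fun i j => AK.ofFamily_surjective (M i j)
  choose β hβ using fun i => AL.ofFamily_surjective (AL.ofField Fq L (b i))
  choose ζ hζ using fun j => AL.ofFamily_surjective (AL.ofField Fq L (z j))
  choose κ hκ using fun i j => AK.ofFamily_surjective
    (algebraMap (RatFunc Fq) (AK Fq) (Algebra.trace (RatFunc Fq) L (z j * b i)))
  have hF (j : Fin n) : ∀ᶠ P in cofinite, algebraMap Fq[X] (RL Fq L) P.1 ∣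
      β j P ^ Nat.card Fq ^ P.1.natDegree -
        ∑ i, algebraMap Fq[X] (RL Fq L) (m i j P) * β i P := by
    have h := frob_ofField_basis b j
    rw [← hM] at h
    simp only [← hβ, ← hm, Algebra.smul_def, AL.algebraMap_ofFamily, ← map_mul, ← map_sum] at h
    have h' := (AL.ofFamily_eq_iff (fun P => β j P ^ Nat.card Fq ^ P.1.natDegree) _).1 h
    simpa only [Finset.sum_apply, Pi.mul_apply] using h'
  refine isFrobEval_iff.2 ⟨∑ j, ∑ i, κ i j * m i j, ?_, ?_⟩
  · simp only [map_sum, map_mul, hm, hκ, Algebra.smul_def]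
  filter_upwards [
    eventually_all.2 fun j => FrobPlace.eventually_base (L := L) (hF j),
    eventually_all.2 fun i => eventually_congrMod_galois (hβ i).symm,
    eventually_all.2 fun j => eventually_congrMod_galois (hζ j).symm,
    eventually_all.2 fun i => eventually_all.2 fun j => congrMod_algebraMap (L := L) (hκ i j).symm]
    with t ht hb hz hk
  let G (σ : Gal(L/RatFunc Fq)) := galRestrict Fq[X] (RatFunc Fq) L (RL Fq L) σ
  -- residues of the conjugates `τ (σ (b j))`, where `τ` is the Frobenius
  have h1 (σ : Gal(L/RatFunc Fq)) (j : Fin n) : CongrMod t.prime (t.frob (σ (b j)))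
      (∑ i, algebraMap Fq[X] (RL Fq L) (m i j t.base) * G σ (β i t.base)) := by
    refine (hb j σ).frob.congr_right ?_
    have h := map_dvd (G σ) (ht j)
    rw [AlgEquiv.commutes] at h
    simpa only [map_sub, map_pow, map_sum, map_mul, AlgEquiv.commutes] using mem_of_dvd t.prime h
  -- residues of the traces `Tr (z j * b i)`
  have h2 (i j : Fin n) : ∑ σ, G σ (ζ j t.base) * G σ (β i t.base) -
      algebraMap Fq[X] (RL Fq L) (κ i j t.base) ∈ t.prime := by
    refine CongrMod.sub_mem (x := algebraMap (RatFunc Fq) L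
      (Algebra.trace (RatFunc Fq) L (z j * b i))) ?_ (hk i j)
    rw [trace_eq_sum_automorphisms]
    refine CongrMod.sum _ fun σ _ => ?_
    rw [map_mul]
    exact (hz j σ).mul (hb i σ)
  refine (CongrMod.sum Finset.univ fun σ _ => CongrMod.sum Finset.univ fun j _ =>
    (hz j σ).mul (h1 σ j)).congr_right ?_
  have h3 : ∑ σ, ∑ j, G σ (ζ j t.base) *
        (∑ i, algebraMap Fq[X] (RL Fq L) (m i j t.base) * G σ (β i t.base)) -
      algebraMap Fq[X] (RL Fq L) ((∑ j, ∑ i, κ i j * m i j) t.base) =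
      ∑ j, ∑ i, algebraMap Fq[X] (RL Fq L) (m i j t.base) *
        (∑ σ, G σ (ζ j t.base) * G σ (β i t.base) -
          algebraMap Fq[X] (RL Fq L) (κ i j t.base)) := by
    rw [Finset.sum_comm]
    simp only [Finset.sum_apply, map_sum, ← Finset.sum_sub_distrib, Pi.mul_apply, map_mul]
    refine Finset.sum_congr rfl fun j _ => ?_
    simp only [Finset.mul_sum, mul_sub, Finset.sum_sub_distrib]
    rw [Finset.sum_comm]
    refine congrArg₂ _ (Finset.sum_congr rfl fun i _ => Finset.sum_congr rfl fun σ _ => by ring)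
      (Finset.sum_congr rfl fun i _ => mul_comm _ _)
  change ∑ σ, ∑ j, G σ (ζ j t.base) * _ - _ ∈ _
  rw [h3]
  exact t.prime.sum_mem fun j _ => t.prime.sum_mem fun i _ => t.prime.mul_mem_left _ (h2 i j)

/-- For every basis, the values of equivariant functions at the Frobenius elements are exactly
the `K`-linear combinations of the matrix entries of the Frobenius. -/
theorem mem_span_matrix_iff {n : ℕ} (b : Module.Basis (Fin n) (RatFunc Fq) L) (α : AK Fq) :
    α ∈ Submodule.span (RatFunc Fq) (Set.range fun ij : Fin n × Fin n =>
        LinearMap.toMatrix (b.baseChange (AK Fq)) (b.baseChange (AK Fq))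
          (frobAK Fq L).toLinearMap ij.1 ij.2) ↔
      ∃ g : Gal(L/RatFunc Fq) → L,
        (∀ σ τ : Gal(L/RatFunc Fq), g (σ * τ * σ⁻¹) = σ (g τ)) ∧ IsFrobEval g α := by
  constructor
  · intro h
    obtain ⟨k, rfl⟩ := (Submodule.mem_span_range_iff_exists_fun _).1 h
    refine ⟨frobTrace (fun j => ∑ i, k (i, j) • b.traceDual i) b, frobTrace_conj _ _, ?_⟩
    convert isFrobEval_frobTrace_basis b _ using 1
    rw [Fintype.sum_prod_type_right]
    refine Finset.sum_congr rfl fun j _ => Finset.sum_congr rfl fun i _ => ?_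
    congr 1
    simp only [Finset.sum_mul, smul_mul_assoc, map_sum, map_smul, b.trace_traceDual_mul]
    simp
  · rintro ⟨g, hg, hα⟩
    obtain ⟨z, rfl⟩ := exists_frobTrace_eq b g hg
    rw [hα.unique (isFrobEval_frobTrace_basis b z)]
    exact Submodule.sum_mem _ fun j _ => Submodule.sum_mem _ fun i _ =>
      Submodule.smul_mem _ _ (Submodule.subset_span ⟨(i, j), rfl⟩)

end Matrix

/-! ### Linear recurrences with separable eigen polynomial -/

section Recurrence

variable {K L : Type*} [Field K] [Field L] [Algebra K L]

/-- The `L`-linear functional on `L[X]` with `X ^ n ↦ a n`. -/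
noncomputable def seqFunctional (L : Type*) [Field L] [Algebra K L] (a : ℕ → K) : L[X] →ₗ[L] L :=
  lsum fun n => algebraMap K L (a n) • LinearMap.id

theorem seqFunctional_monomial (a : ℕ → K) (n : ℕ) (c : L) :
    seqFunctional L a (monomial n c) = algebraMap K L (a n) * c := by
  simp [seqFunctional, lsum_apply, sum_monomial_index, Algebra.smul_def]

theorem seqFunctional_map (a : ℕ → K) (σ : Gal(L/K)) (h : L[X]) :
    seqFunctional L a (h.map (σ : L →+* L)) = σ (seqFunctional L a h) := by
  induction h using Polynomial.induction_on' with
  | add p q hp hq => rw [Polynomial.map_add, map_add, map_add, map_add, hp, hq]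
  | monomial n c =>
    rw [map_monomial, seqFunctional_monomial, seqFunctional_monomial, map_mul, AlgEquiv.commutes]
    rfl

/-- The functional of a solution vanishes on the ideal generated by the eigen polynomial. -/
theorem seqFunctional_charPoly_mul {E : LinearRecurrence K} {a : ℕ → K} (ha : E.IsSolution a)
    (h : L[X]) : seqFunctional L a (E.charPoly.map (algebraMap K L) * h) = 0 := by
  induction h using Polynomial.induction_on' with
  | add p q hp hq => rw [mul_add, map_add, hp, hq, add_zero]
  | monomial n c =>
    rw [LinearRecurrence.charPoly, Polynomial.map_sub, Polynomial.map_sum, sub_mul,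
      Finset.sum_mul, map_sub, map_sum]
    simp only [map_monomial, monomial_mul_monomial, seqFunctional_monomial]
    rw [add_comm E.order n, ha n, map_sum, Finset.sum_mul, sub_eq_zero]
    refine Finset.sum_congr rfl fun i _ => ?_
    rw [map_mul, map_one, add_comm n]
    ring

/-- A field endomorphism that permutes the nodes permutes the Lagrange basis. -/
theorem map_lagrangeBasis [DecidableEq L] {s : Finset L} {σ : L →+* L}
    (hs : s.image σ = s) (x : L) :
    (Lagrange.basis s id x).map σ = Lagrange.basis s id (σ x) := by
  rw [Lagrange.basis, Lagrange.basis, Polynomial.map_prod]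
  conv_rhs => rw [← hs, ← Finset.image_erase σ.injective,
    Finset.prod_image σ.injective.injOn]
  refine Finset.prod_congr rfl fun y _ => ?_
  simp [Lagrange.basisDivisor]

/-- A solution of a linear recurrence with roots `x` in `L`, taken along the multiples of a large
power `p ^ m` of the characteristic exponent, is a linear combination of the sequences
`x ^ (p ^ m * n)`, with no polynomial factors. -/
theorem exists_eq_sum_pow_of_isSolution [DecidableEq L] {E : LinearRecurrence K} {a : ℕ → K}
    (ha : E.IsSolution a) (hE : (E.charPoly.map (algebraMap K L)).Splits) (p m : ℕ)
    [ExpChar L p] (hm : E.order ≤ p ^ m) :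
    ∃ c : L → L, (∀ (σ : Gal(L/K)) (x : L), c (σ x) = σ (c x)) ∧
      ∀ n, algebraMap K L (a (p ^ m * n)) =
        ∑ x ∈ (E.charPoly.aroots L).toFinset, c x * x ^ (p ^ m * n) := by
  set s := (E.charPoly.aroots L).toFinset with hs
  have hne : E.charPoly ≠ 0 := E.charPoly_monic.ne_zero
  have himage (σ : Gal(L/K)) : s.image (σ : L →+* L) = s := by
    refine Finset.eq_of_subset_of_card_le (fun y hy => ?_)
      (Finset.card_image_of_injective _ σ.injective).ge
    obtain ⟨x, hx, rfl⟩ := Finset.mem_image.1 hy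
    simp only [hs, Multiset.mem_toFinset, mem_aroots, hne, ne_eq, not_false_eq_true,
      true_and] at hx ⊢
    exact (aeval_algHom_apply (σ : L →ₐ[K] L) x _).trans (by rw [hx, map_zero])
  -- the coefficient at `x` is the functional at the `p ^ m`-th power of the Lagrange polynomial
  refine ⟨fun x => seqFunctional L a (Lagrange.basis s id x ^ p ^ m), fun σ x => ?_, fun n => ?_⟩
  · change seqFunctional L a (Lagrange.basis s id ((σ : L →+* L) x) ^ p ^ m) = _
    rw [← seqFunctional_map, Polynomial.map_pow, map_lagrangeBasis (himage σ)]
  -- `X ^ n` and its Lagrange interpolation at the roots agree modulo `∏ (X - x)`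
  have h1 : ∏ x ∈ s, (X - C x) ∣ X ^ n - ∑ x ∈ s, C (x ^ n) * Lagrange.basis s id x := by
    refine Finset.prod_dvd_of_coprime
      (fun x _ y _ hxy => isCoprime_X_sub_C_of_isUnit_sub (sub_ne_zero.2 hxy).isUnit)
      fun x hx => ?_
    rw [dvd_iff_isRoot, IsRoot.def]
    have := Lagrange.eval_interpolate_at_node (fun x : L => x ^ n) (v := id)
      Function.injective_id.injOn hx
    rw [Lagrange.interpolate_apply] at this
    rw [eval_sub, eval_pow, eval_X, sub_eq_zero]
    exact this.symm
  -- the multiplicity of a root is at most `E.order ≤ p ^ m`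
  have h2 : E.charPoly.map (algebraMap K L) ∣ (∏ x ∈ s, (X - C x)) ^ p ^ m := by
    rw [hE.eq_prod_roots, (E.charPoly_monic.map _).leadingCoeff, C_1, one_mul,
      Finset.prod_multiset_map_count, ← Finset.prod_pow]
    refine Finset.prod_dvd_prod_of_dvd _ _ fun x _ => pow_dvd_pow _ ?_
    refine (Multiset.count_le_card _ _).trans ((card_roots' _).trans ?_)
    rwa [natDegree_map, natDegree_eq_of_degree_eq_some E.charPoly_degree_eq_order]
  -- raising the interpolation congruence to the power `p ^ m` is additive
  obtain ⟨h, hh⟩ := h2.trans (pow_dvd_pow_of_dvd h1 (p ^ m))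
  have h3 := seqFunctional_charPoly_mul ha h
  rw [← hh, sub_pow_expChar_pow, sum_pow_char_pow, map_sub, map_sum, sub_eq_zero, ← pow_mul,
    mul_comm n, X_pow_eq_monomial, seqFunctional_monomial, mul_one] at h3
  rw [h3]
  refine Finset.sum_congr rfl fun x _ => ?_
  rw [mul_pow, ← C_pow, ← smul_eq_C_mul, map_smul, smul_eq_mul, mul_comm, ← pow_mul, mul_comm n]

/-- The traces `∑ j, Tr (z j * y j ^ n)` satisfy the linear recurrence whose eigen polynomial is
the product of the minimal polynomials of the `y j`. -/
theorem exists_linearRecurrence_trace {ι : Type*} [Fintype ι] [FiniteDimensional K L]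
    [Algebra.IsSeparable K L] (z y : ι → L) :
    ∃ E : LinearRecurrence K, IsProdSeparable E.charPoly ∧
      E.IsSolution fun n => ∑ j, Algebra.trace K L (z j * y j ^ n) := by
  set f : K[X] := ∏ j, minpoly K (y j) with hf
  have hmonic : f.Monic := monic_prod_of_monic _ _ fun j _ =>
    minpoly.monic (Algebra.IsIntegral.isIntegral (y j))
  have hsum : f = X ^ f.natDegree + ∑ i : Fin f.natDegree, C (f.coeff i) * X ^ (i : ℕ) := by
    rw [Fin.sum_univ_eq_sum_range (fun i => C (f.coeff i) * X ^ i)]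
    exact hmonic.as_sum
  refine ⟨⟨f.natDegree, fun i => -f.coeff i⟩, ?_, fun n => ?_⟩
  · refine ⟨Finset.univ.val.map fun j => minpoly K (y j), ?_, ?_⟩
    · intro h hh
      obtain ⟨j, _, rfl⟩ := Multiset.mem_map.1 hh
      exact Algebra.IsSeparable.isSeparable K (y j)
    · change f = _
      rw [LinearRecurrence.charPoly]
      conv_lhs => rw [hsum]
      simp only [← C_mul_X_pow_eq_monomial, C_1, one_mul, C_neg, neg_mul, Finset.sum_neg_distrib,
        sub_neg_eq_add]
  · have hy (j : ι) : y j ^ f.natDegree = -∑ i : Fin f.natDegree, f.coeff i • y j ^ (i : ℕ) := by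
      have h0 : aeval (y j) f = 0 := by
        rw [hf, map_prod]
        exact Finset.prod_eq_zero (Finset.mem_univ j) (minpoly.aeval K (y j))
      rw [hsum] at h0
      simp only [map_add, map_pow, aeval_X, map_sum, map_mul, aeval_C, ← Algebra.smul_def] at h0
      exact eq_neg_of_add_eq_zero_left h0
    simp only [Finset.mul_sum]
    rw [Finset.sum_comm]
    refine Finset.sum_congr rfl fun j _ => ?_
    rw [pow_add, hy j, mul_neg, mul_neg, map_neg, Finset.mul_sum, Finset.mul_sum, map_sum,
      ← Finset.sum_neg_distrib]
    refine Finset.sum_congr rfl fun i _ => ?_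
    rw [mul_smul_comm, mul_smul_comm, map_smul, smul_eq_mul, neg_mul, pow_add]

end Recurrence

/-! ### Splitting fields of products of separable polynomials -/

theorem IsProdSeparable.isSeparable_of_aeval_eq_zero {K L : Type*} [Field K] [Field L]
    [Algebra K L] {f : K[X]} (hf : IsProdSeparable f) {x : L} (hx : aeval x f = 0) :
    IsSeparable K x := by
  obtain ⟨s, hs, rfl⟩ := hf
  rw [map_multiset_prod, Multiset.prod_eq_zero_iff, Multiset.mem_map] at hx
  obtain ⟨h, hh, hhx⟩ := hx
  exact (hs h hh).of_dvd (minpoly.dvd K x hhx)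

/-- The splitting field of a product of separable polynomials is separable. -/
theorem IsProdSeparable.isGalois_splittingField {K : Type*} [Field K] {f : K[X]}
    (hf : IsProdSeparable f) : IsGalois K f.SplittingField := by
  have hsep : Algebra.IsSeparable K (IntermediateField.adjoin K (f.rootSet f.SplittingField)) := by
    rw [IntermediateField.isSeparable_adjoin_iff_isSeparable]
    intro x hx
    exact hf.isSeparable_of_aeval_eq_zero (mem_rootSet.1 hx).2
  have htop : IntermediateField.adjoin K (f.rootSet f.SplittingField) = ⊤ := by
    rw [eq_top_iff]
    intro x _
    have hx : x ∈ Algebra.adjoin K (f.rootSet f.SplittingField) := by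
      rw [SplittingField.adjoin_rootSet]
      trivial
    exact IntermediateField.algebra_adjoin_le_adjoin _ _ hx
  rw [htop] at hsep
  have h1 : Algebra.IsSeparable K f.SplittingField :=
    .of_algHom K _ (IntermediateField.topEquiv (F := K) (E := f.SplittingField)).symm.toAlgHom
  have h2 : Normal K f.SplittingField := Normal.of_isSplittingField f
  exact ⟨⟩

/-! ### Recurrent sequences and Frobenius values -/

section RecurrenceClass

variable {Fq : Type u} [Field Fq]

/-- A congruence in `R_L` between elements coming from `K` and `R` descends to `R`. -/
theorem CongrMod.of_liesOver {L : Type u} [Field L] [Algebra (RatFunc Fq) L] [Algebra Fq[X] L]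
    [IsScalarTower Fq[X] (RatFunc Fq) L] {P : MonicIrred Fq} {𝔭 : Ideal (RL Fq L)} [𝔭.IsPrime]
    [FiniteDimensional (RatFunc Fq) L]
    [𝔭.LiesOver (Ideal.span {P.1})] {x : RatFunc Fq} {c : Fq[X]}
    (h : CongrMod 𝔭 (algebraMap (RatFunc Fq) L x) (algebraMap Fq[X] (RL Fq L) c)) :
    CongrMod (Ideal.span {P.1}) x c := by
  have hx : x * algebraMap Fq[X] (RatFunc Fq) x.denom = algebraMap Fq[X] (RatFunc Fq) x.num := by
    have hd : algebraMap Fq[X] (RatFunc Fq) x.denom ≠ 0 :=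
      RatFunc.algebraMap_ne_zero x.denom_ne_zero
    have := div_mul_cancel₀ (algebraMap Fq[X] (RatFunc Fq) x.num) hd
    rwa [RatFunc.num_div_denom] at this
  have h1 := h.mul (CongrMod.of_algebraMap (algebraMap Fq[X] (RL Fq L) x.denom))
  have h2 : algebraMap (RatFunc Fq) L x *
      algebraMap (RL Fq L) L (algebraMap Fq[X] (RL Fq L) x.denom) =
      algebraMap (RL Fq L) L (algebraMap Fq[X] (RL Fq L) x.num) := by
    simp only [← IsScalarTower.algebraMap_apply Fq[X] (RL Fq L) L]
    simp only [IsScalarTower.algebraMap_apply Fq[X] (RatFunc Fq) L, ← map_mul, hx]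
  rw [h2, ← map_mul] at h1
  have h3 := (CongrMod.of_algebraMap _).sub_mem h1
  rw [← map_sub, algebraMap_mem_iff (P := P.1)] at h3
  refine ⟨x.num, x.denom, fun hd => ?_, hx, Ideal.mem_span_singleton.2 h3⟩
  -- otherwise `P` would divide both the numerator and the denominator of `x`
  rw [Ideal.mem_span_singleton] at hd
  exact P.2.2.not_isUnit ((RatFunc.isCoprime_num_denom x).isUnit_of_dvd'
    ((dvd_sub_left (hd.mul_left c)).1 h3) hd)

theorem CongrMod.algebraMap_of_liesOver {L : Type u} [Field L] [Algebra (RatFunc Fq) L]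
    [Algebra Fq[X] L] [IsScalarTower Fq[X] (RatFunc Fq) L] {P : Fq[X]} {𝔭 : Ideal (RL Fq L)}
    [𝔭.LiesOver (Ideal.span {P})] {x : RatFunc Fq} {c : Fq[X]}
    (h : CongrMod (Ideal.span {P}) x c) :
    CongrMod 𝔭 (algebraMap (RatFunc Fq) L x) (algebraMap Fq[X] (RL Fq L) c) := by
  obtain ⟨a, b, hb, hx, hc⟩ := h
  refine ⟨algebraMap _ _ a, algebraMap _ _ b, ?_, ?_, ?_⟩
  · rwa [algebraMap_mem_iff (P := P), ← Ideal.mem_span_singleton]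
  · simp only [← IsScalarTower.algebraMap_apply Fq[X] (RL Fq L) L]
    simp only [IsScalarTower.algebraMap_apply Fq[X] (RatFunc Fq) L, ← map_mul, hx]
  · rwa [← map_mul, ← map_sub, algebraMap_mem_iff (P := P), ← Ideal.mem_span_singleton]

/-- Only finitely many monic irreducible polynomials have degree below a given bound. -/
theorem eventually_le_natDegree [Finite Fq] (m : ℕ) :
    ∀ᶠ P : MonicIrred Fq in cofinite, m ≤ P.1.natDegree := by
  have h (d : ℕ) : ∀ᶠ P : MonicIrred Fq in cofinite, P.1.natDegree ≠ d := by
    rcases Nat.eq_zero_or_pos d with rfl | hd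
    · exact Eventually.of_forall fun P => P.2.2.natDegree_pos.ne'
    have hr : (X ^ Nat.card Fq ^ d - X : Fq[X]) ≠ 0 :=
      FiniteField.X_pow_card_sub_X_ne_zero Fq (Nat.one_lt_pow hd.ne' Finite.one_lt_card)
    filter_upwards [(finite_dvd hr).compl_mem_cofinite] with P hP hPd
    exact hP (hPd ▸ dvd_pow_card_sub P X)
  filter_upwards [(Filter.eventually_all_finset (Finset.range m)).2 fun d _ => h d] with P hP
  by_contra hlt
  exact hP _ (Finset.mem_range.2 (not_le.1 hlt)) rfl

variable [Finite Fq]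

/-- With `a (q ^ d) = ∑ x, c x * x ^ q ^ d` for large `d`, the sum running over the roots `x` of the
eigen polynomial, the equivariant function is `τ ↦ ∑ x, c x * τ x`. -/
theorem exists_isFrobEval_of_isSolution {L : Type u} [Field L] [Algebra (RatFunc Fq) L]
    [Algebra Fq[X] L] [IsScalarTower Fq[X] (RatFunc Fq) L] [FiniteDimensional (RatFunc Fq) L]
    {E : LinearRecurrence (RatFunc Fq)} {a : ℕ → RatFunc Fq} (ha : E.IsSolution a)
    (hE : (E.charPoly.map (algebraMap (RatFunc Fq) L)).Splits) {α : AK Fq}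
    (hα : IsClassOf α fun P => a (Nat.card Fq ^ P.1.natDegree)) :
    ∃ g : Gal(L/RatFunc Fq) → L,
      (∀ σ τ : Gal(L/RatFunc Fq), g (σ * τ * σ⁻¹) = σ (g τ)) ∧ IsFrobEval g α := by
  classical
  have := Fintype.ofFinite Fq
  obtain ⟨p, hp, e, hprime, hcard⟩ := FiniteField.card' Fq
  rw [← Nat.card_eq_fintype_card] at hcard
  have : CharP Fq[X] p := inferInstance
  have hinj : Function.Injective (algebraMap Fq[X] L) := by
    rw [IsScalarTower.algebraMap_eq Fq[X] (RatFunc Fq) L]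
    exact (algebraMap (RatFunc Fq) L).injective.comp (IsFractionRing.injective Fq[X] (RatFunc Fq))
  have : CharP L p := charP_of_injective_ringHom hinj p
  have : ExpChar L p := .prime hprime
  obtain ⟨c, hc, hac⟩ := exists_eq_sum_pow_of_isSolution ha hE p E.order
    (Nat.lt_pow_self hprime.one_lt).le
  set s := (E.charPoly.aroots L).toFinset with hs
  have hmem (σ : Gal(L/RatFunc Fq)) (x : L) (hx : x ∈ s) : σ x ∈ s := by
    simp only [hs, Multiset.mem_toFinset, mem_aroots, E.charPoly_monic.ne_zero, ne_eq,
      not_false_eq_true, true_and] at hx ⊢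
    exact (aeval_algHom_apply (σ : L →ₐ[RatFunc Fq] L) x _).trans (by rw [hx, map_zero])
  refine ⟨fun τ => ∑ x ∈ s, c x * τ x, fun σ τ => ?_, ?_⟩
  · rw [map_sum]
    refine (Finset.sum_nbij' (fun x => σ x) (fun x => σ⁻¹ x) (hmem σ) (hmem σ⁻¹) ?_ ?_ ?_).symm
    · exact fun x _ => σ.symm_apply_apply x
    · exact fun x _ => σ.apply_symm_apply x
    · intro x _
      rw [hc, map_mul]
      congr 1
      rw [AlgEquiv.mul_apply, AlgEquiv.mul_apply]
      exact congrArg (fun y => σ (τ y)) (σ.symm_apply_apply x).symm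
  · obtain ⟨d, rfl, hd⟩ := hα
    refine isFrobEval_iff.2 ⟨d, rfl, ?_⟩
    filter_upwards [FrobPlace.eventually_base hd, FrobPlace.eventually_base
      (eventually_le_natDegree E.order), eventually_congrMod_sum_mul_frob s c id] with t h1 h2 h3
    obtain ⟨x, hx1, hx2⟩ := h3
    have h4 := h1.algebraMap_of_liesOver (𝔭 := t.prime)
    obtain ⟨n, hn⟩ : p ^ E.order ∣ Nat.card Fq ^ t.base.1.natDegree := by
      rw [hcard, ← pow_mul]
      exact pow_dvd_pow p (h2.trans (Nat.le_mul_of_pos_left _ e.pos))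
    simp only [hn, hac] at h4
    rw [hn] at hx2
    exact hx1.congr_right (hx2.sub_mem h4)

/-- If `g = frobTrace z b`, the recurrent sequence is `n ↦ ∑ j, Tr (z j * b j ^ n)`. -/
theorem exists_isSolution_of_isFrobEval {L : Type u} [Field L] [Algebra (RatFunc Fq) L]
    [Algebra Fq[X] L] [IsScalarTower Fq[X] (RatFunc Fq) L] [FiniteDimensional (RatFunc Fq) L]
    [IsGalois (RatFunc Fq) L] {g : Gal(L/RatFunc Fq) → L}
    (hg : ∀ σ τ : Gal(L/RatFunc Fq), g (σ * τ * σ⁻¹) = σ (g τ)) {α : AK Fq}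
    (hα : IsFrobEval g α) :
    ∃ (E : LinearRecurrence (RatFunc Fq)) (a : ℕ → RatFunc Fq),
      E.IsSolution a ∧ IsProdSeparable E.charPoly ∧
        IsClassOf α (fun P => a (Nat.card Fq ^ P.1.natDegree)) := by
  let b := Module.finBasis (RatFunc Fq) L
  obtain ⟨z, rfl⟩ := exists_frobTrace_eq b g hg
  obtain ⟨E, hE, ha⟩ := exists_linearRecurrence_trace (K := RatFunc Fq) z b
  refine ⟨E, _, ha, hE, ?_⟩
  obtain ⟨c, rfl, hc⟩ := isFrobEval_iff.1 hα
  refine ⟨c, rfl, ?_⟩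
  have h := hc.and (eventually_congrMod_sum_mul_frob (Fq := Fq)
    (Finset.univ : Finset (Gal(L/RatFunc Fq) × _)) (fun i => i.1 (z i.2)) fun i => i.1 (b i.2))
  rw [frobPlaces, eventually_comap] at h
  filter_upwards [h] with P hP
  obtain ⟨t, rfl⟩ := FrobPlace.exists_base_eq (L := L) P
  obtain ⟨h1, d, h2, h3⟩ := hP t rfl
  rw [Fintype.sum_prod_type] at h2
  refine CongrMod.of_liesOver (𝔭 := t.prime) ?_
  have h4 (n : ℕ) : algebraMap (RatFunc Fq) L
      (∑ j, Algebra.trace (RatFunc Fq) L (z j * b j ^ n)) =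
      ∑ i : Gal(L/RatFunc Fq) × _, i.1 (z i.2) * i.1 (b i.2) ^ n := by
    simp only [map_sum, trace_eq_sum_automorphisms, map_mul, map_pow]
    rw [Finset.sum_comm, Fintype.sum_prod_type]
  rw [h4]
  exact h3.congr_right (h2.sub_mem h1)

end RecurrenceClass

end FiniteSeparable

theorem mainTheorem1 {Fq : Type u} [Field Fq] [Finite Fq] (α : AK Fq) :
    List.TFAE [
      ∃ (E : LinearRecurrence (RatFunc Fq)) (a : ℕ → RatFunc Fq),
        E.IsSolution a ∧ IsProdSeparable E.charPoly ∧
          IsClassOf α (fun P => a (Nat.card Fq ^ P.1.natDegree)),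
      ∃ (L : Type u) (_ : Field L) (_ : Algebra (RatFunc Fq) L) (_ : Algebra Fq[X] L)
        (_ : IsScalarTower Fq[X] (RatFunc Fq) L) (_ : FiniteDimensional (RatFunc Fq) L)
        (_ : IsGalois (RatFunc Fq) L) (g : Gal(L/RatFunc Fq) → L),
        (∀ σ τ : Gal(L/RatFunc Fq), g (σ * τ * σ⁻¹) = σ (g τ)) ∧ IsFrobEval g α,
      ∃ (L : Type u) (_ : Field L) (_ : Algebra (RatFunc Fq) L) (_ : Algebra Fq[X] L)
        (_ : IsScalarTower Fq[X] (RatFunc Fq) L) (_ : FiniteDimensional (RatFunc Fq) L)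
        (_ : IsGalois (RatFunc Fq) L),
        ∀ (n : ℕ) (b : Module.Basis (Fin n) (RatFunc Fq) L),
          α ∈ Submodule.span (RatFunc Fq)
            (Set.range fun ij : Fin n × Fin n =>
              LinearMap.toMatrix (b.baseChange (AK Fq)) (b.baseChange (AK Fq))
                (frobAK Fq L).toLinearMap ij.1 ij.2)] := by
  tfae_have 1 → 2 := by
    rintro ⟨E, a, ha, hE, hα⟩
    have := hE.isGalois_splittingField
    obtain ⟨g, hg, h⟩ := exists_isFrobEval_of_isSolution ha
      (SplittingField.splits E.charPoly) hα
    exact ⟨E.charPoly.SplittingField, inferInstance, inferInstance, inferInstance, inferInstance,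
      inferInstance, inferInstance, g, hg, h⟩
  tfae_have 2 → 1 := by
    rintro ⟨L, _, _, _, _, _, _, g, hg, h⟩
    exact exists_isSolution_of_isFrobEval hg h
  tfae_have 2 → 3 := by
    rintro ⟨L, i1, i2, i3, i4, i5, i6, g, hg, h⟩
    exact ⟨L, i1, i2, i3, i4, i5, i6, fun n b => (mem_span_matrix_iff b α).2 ⟨g, hg, h⟩⟩
  tfae_have 3 → 2 := by
    rintro ⟨L, i1, i2, i3, i4, i5, i6, h⟩
    obtain ⟨g, hg, hα⟩ := (mem_span_matrix_iff (Module.finBasis (RatFunc Fq) L) α).1 (h _ _)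
    exact ⟨L, i1, i2, i3, i4, i5, i6, g, hg, hα⟩
  tfae_finish
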